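/- Let $\pmb{A}$ be an $m\times n$ real random matrix ($m\ge 1$) whose rows are independent and identically distributed, whose columns are identically distributed (not necessarily independent), and whose entries satisfy $|A_{ij}|\le 1/\sqrt m$ (almost surely). Let $\mathcal S,\mathcal R\subseteq\{1,\dots,n\}$ be index sets of size $k$ with $|\mathcal S\cap\mathcal R|=i$, where $1\le i<k$, and let $\pmb A_{\mathcal S},\pmb A_{\mathcal R}$ be the $m\times k$ submatrices of $\pmb A$ formed by the columns indexed by $\mathcal S$ and $\mathcal R$. Let $\pmb X$ be the $k\times k$ outer product $v v^T$, where $v^T$ is the first row of $\sqrt{m/k}\,\pmb A_{\mathcal S}$, and let $\pmb Y$ be the analogous matrix for $\sqrt{m/k}\,\pmb A_{\mathcal R}$. Let $\tau_q$ be a real constant such that $$\mathbb E\big[\operatorname{Tr}(\mathbf C\pmb X)\operatorname{Tr}(\mathbf D\pmb Y)\big]\le \tau_q \operatorname{Tr}(\mathbf C)\operatorname{Tr}(\mathbf D)$$ for all positive semidefinite $k\times k$ matrices $\mathbf C,\mathbf D$. Write $\varsigma_{\max},\varsigma_{\min}$ for the largest and the smallest eigenvalue of a symmetric matrix, put $\tau_{p,\max}=\varsigma_{\max}(\mathbb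 E\pmb X)$ and $\tau_{p,\min}=\varsigma_{\min}(\mathbb E\pmb X)$, and assume $\max(\tau_{p,\max},\tau_{p,\min})\le\sqrt{\tau_q}$. Let $$\mathcal D(x\|y)=x\log\frac xy+(1-x)\log\frac{1-x}{1-y}$$ (natural logarithms), and let $$c_4(a,k,c_1,c_2)=\frac12\sqrt{1+\frac{4(c_2^{-1}-1)(1-\frac ak)\frac ak}{(1-c_1)^2}}-\frac12,$$ $$c_3(a,k,c_1,c_2)=\frac ak\log\left(\frac{c_4+\frac ak}{\frac ak}\right)-\frac12\log\left(c_2(1+c_4)^2+(1-c_2)\left(\frac{1-\frac ak}{1-c_1}\right)^2\right),\qquad c_4=c_4(a,k,c_1,c_2).$$ Let $\sigma^2_{\max}(B)$ and $\sigma^2_{\min}(B)$ denote the largest and the smallest eigenvalue of $B^TB$ (the squared extreme singular values of the $m\times k$ matrix $B$). 1. If $\varsigma_{\max}(\mathbb E\pmb Y)\le\tau_{p,\max}$ and $\tau_q<\tau_{p,\max}$, then for every $a$ with $k\,\tau_{p,\max}<a<k$, $$\Pr\{\sigma^2_{\max}(\pmb A_{\mathcal S})>a,\ \sigma^2_{\max}(\pmb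 A_{\mathcal R})>a\}\le k^2\exp\left(-2m\left(\mathcal D\Big(\frac ak\Big\|\frac{\tau_q}{\tau_{p,\max}}\Big)+c_3\Big(a,k,\frac{\tau_q}{\tau_{p,\max}},\frac{\tau_{p,\max}^2}{\tau_q}\Big)\right)\right).$$ 2. If $\varsigma_{\min}(\mathbb E\pmb Y)\ge\tau_{p,\min}$ and $\tau_q<\tau_{p,\min}$, then for every $a$ with $0<a<k\,\tau_{p,\min}$, $$\Pr\{\sigma^2_{\min}(\pmb A_{\mathcal S})<a,\ \sigma^2_{\min}(\pmb A_{\mathcal R})<a\}\le k^2\exp\left(-2m\left(\mathcal D\Big(\frac ak\Big\|\frac{\tau_q}{\tau_{p,\min}}\Big)+c_3\Big(a,k,\frac{\tau_q}{\tau_{p,\min}},\frac{\tau_{p,\min}^2}{\tau_q}\Big)\right)\right).$$ -/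

import Mathlib

open MeasureTheory ProbabilityTheory

noncomputable section

namespace JointTail

/-- The submatrix `A_S` formed by the columns of `A` indexed by the size-`k` set `S`
(in increasing order). -/
def colSubmatrix {m n k : ℕ} (A : Matrix (Fin m) (Fin n) ℝ) (S : Finset (Fin n))
    (hS : S.card = k) : Matrix (Fin m) (Fin k) ℝ :=
  A.submatrix id (S.orderEmbOfFin hS)

/-- The outer product of the `r`-th row of `B`: the matrix with entries `B r l * B r w`. -/
def rowOuter {m k : ℕ} (B : Matrix (Fin m) (Fin k) ℝ) (r : Fin m) :
    Matrix (Fin k) (Fin k) ℝ :=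
  Matrix.vecMulVec (B r) (B r)

/-- Entrywise expectation of a random matrix. -/
def expMatrix {Ω : Type*} [MeasurableSpace Ω] (μ : Measure Ω) {k : ℕ}
    (X : Ω → Matrix (Fin k) (Fin k) ℝ) : Matrix (Fin k) (Fin k) ℝ :=
  Matrix.of fun l w => ∫ ω, X ω l w ∂μ

/-- Largest (real) eigenvalue; used only for nonempty symmetric matrices. -/
def eigMax {k : ℕ} (M : Matrix (Fin k) (Fin k) ℝ) : ℝ := sSup (spectrum ℝ M)

/-- Smallest (real) eigenvalue; used only for nonempty symmetric matrices. -/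
def eigMin {k : ℕ} (M : Matrix (Fin k) (Fin k) ℝ) : ℝ := sInf (spectrum ℝ M)

/-- Square of the largest singular value of an `m × k` matrix, `1 ≤ k`. -/
def sqSingMax {m k : ℕ} (B : Matrix (Fin m) (Fin k) ℝ) : ℝ :=
  ((Matrix.toEuclideanLin B).singularValues 0) ^ 2

/-- Square of the smallest of the `k` singular values of an `m × k` matrix, `1 ≤ k`, that is,
the smallest eigenvalue of `Bᵀ B` (it is zero if `m < k`). -/
def sqSingMin {m k : ℕ} (B : Matrix (Fin m) (Fin k) ℝ) : ℝ :=
  ((Matrix.toEuclideanLin B).singularValues (k - 1)) ^ 2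

/-- Binary information divergence `D(a ‖ b)`, with natural logarithms. -/
def binDiv (a b : ℝ) : ℝ :=
  a * Real.log (a / b) + (1 - a) * Real.log ((1 - a) / (1 - b))

/-- The constant `c₄(a, k, c₁, c₂)`. -/
def c4 (a : ℝ) (k : ℕ) (c₁ c₂ : ℝ) : ℝ :=
  1 / 2 * √(1 + 4 * (c₂⁻¹ - 1) * (1 - a / k) * (a / k) / (1 - c₁) ^ 2) - 1 / 2

/-- The constant `c₃(a, k, c₁, c₂)`. -/
def c3 (a : ℝ) (k : ℕ) (c₁ c₂ : ℝ) : ℝ :=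
  a / k * Real.log ((c4 a k c₁ c₂ + a / k) / (a / k))
    - 1 / 2 * Real.log (c₂ * (1 + c4 a k c₁ c₂) ^ 2
        + (1 - c₂) * ((1 - a / k) / (1 - c₁)) ^ 2)

end JointTail

end

/-! This is a Chernoff argument for two matrices at once. The row outer products `X r`, `Y r` sum to
`m/k` times the Gram matrices. On the event, each Gram matrix has an eigenvalue on the required side
of `a`, so each trace of `exp (t • ∑ r, ·)` is at least `exp (t m a / k)`. Markov's inequality for
the product of the two traces reduces the claim to a joint Laplace transform.

That transform is bounded by `k ^ 2 * g ^ m`, where `g = 1 + 2 s τ + s ^ 2 τq` and `s = exp t - 1`,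
by peeling off one row at a time (`lintegral_trace_exp_sum_le`). Golden–Thompson separates the new
row from the others. By independence the exponentials of the others act as fixed positive
semidefinite test matrices `C`, `D`. Convexity replaces `exp (t X)` by `1 + s X`, and the expanded
product is controlled by the first moments and the mixed moment `τq`.

With `c₁ = τq / τ` and `c₂ = τ ^ 2 / τq`, the stationary point of `t α - (1/2) log g`, `α = a / k`,
solves a quadratic whose root is `c4`; the value there is `binDiv + c3`
(`exists_laplace_parameter`). The sign of `t` agrees with that of `α - τ`, so one argument serves
both tails. -/

noncomputable section

namespace JointTail

open Matrix Filter Topology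
open scoped ENNReal

/-! ### Trace inequalities for products of matrices -/

section TraceHolder

variable {n : Type*} [Fintype n] [DecidableEq n]

/-- The product `f 0 * f 1 * ⋯ * f (2 ^ N - 1)`, associated in pairs. -/
def dyadicWord {M : Type*} [Mul M] : ℕ → (ℕ → M) → M
  | 0, f => f 0
  | N + 1, f => dyadicWord N fun i => f (2 * i) * f (2 * i + 1)

lemma dyadicWord_const {M : Type*} [Monoid M] (N : ℕ) (a : M) :
    dyadicWord N (fun _ => a) = a ^ 2 ^ N := by
  induction N generalizing a with
  | zero => simp [dyadicWord]
  | succ N ih => rw [dyadicWord, ih, ← sq, ← pow_mul, ← pow_succ']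

lemma dyadicWord_alternating {M : Type*} [Monoid M] (N : ℕ) (a b : M) :
    dyadicWord (N + 1) (fun i => if i % 2 = 0 then a else b) = (a * b) ^ 2 ^ N := by
  rw [dyadicWord, ← dyadicWord_const]
  congr 1
  funext i
  rw [if_pos (by omega), if_neg (by omega)]

lemma prod_range_two_mul {M : Type*} [CommMonoid M] (N : ℕ) (g : ℕ → M) :
    ∏ i ∈ Finset.range (2 * N), g i = ∏ i ∈ Finset.range N, g (2 * i) * g (2 * i + 1) := by
  induction N with
  | zero => simp
  | succ N ih =>
    rw [Finset.prod_range_succ, ← ih, show 2 * (N + 1) = 2 * N + 1 + 1 by ring,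
      Finset.prod_range_succ, Finset.prod_range_succ, mul_assoc]

lemma trace_mul_pow_comm (A B : Matrix n n ℝ) (N : ℕ) (hN : N ≠ 0) :
    ((A * B) ^ N).trace = ((B * A) ^ N).trace := by
  obtain ⟨N, rfl⟩ := Nat.exists_eq_succ_of_ne_zero hN
  rw [Nat.succ_eq_add_one, pow_succ, ← mul_assoc, mul_pow_mul, Matrix.mul_assoc,
    Matrix.trace_mul_comm, Matrix.mul_assoc, ← pow_succ]

/-- The `2 ^ (N + 1)`-th power of the Schatten norm of exponent `2 ^ (N + 1)`. -/
def schattenPow (N : ℕ) (A : Matrix n n ℝ) : ℝ := ((A * Aᵀ) ^ 2 ^ N).trace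

lemma schattenPow_nonneg (N : ℕ) (A : Matrix n n ℝ) : 0 ≤ schattenPow N A := by
  have h : (A * Aᴴ).PosSemidef := posSemidef_self_mul_conjTranspose A
  rw [conjTranspose_eq_transpose_of_trivial] at h
  exact (h.pow _).trace_nonneg

lemma schattenPow_transpose_mul_self (N : ℕ) (A : Matrix n n ℝ) :
    schattenPow N (Aᵀ * A) = schattenPow (N + 1) A := by
  rw [schattenPow, schattenPow, transpose_mul, transpose_transpose, ← sq, ← pow_mul, ← pow_succ',
    trace_mul_pow_comm _ _ _ (by positivity)]

lemma schattenPow_mul_transpose_self (N : ℕ) (A : Matrix n n ℝ) :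
    schattenPow N (A * Aᵀ) = schattenPow (N + 1) A := by
  rw [schattenPow, schattenPow, transpose_mul, transpose_transpose, ← sq, ← pow_mul, ← pow_succ']

/-- Cauchy–Schwarz for the Frobenius inner product of `A` and `Bᵀ`; the base case of Hölder. -/
lemma trace_mul_sq_le {n : Type*} [Fintype n] (A B : Matrix n n ℝ) :
    (A * B).trace ^ 2 ≤ (A * Aᵀ).trace * (B * Bᵀ).trace := by
  have h := Finset.sum_mul_sq_le_sq_mul_sq (Finset.univ : Finset (n × n))
    (fun p => A p.1 p.2) (fun p => B p.2 p.1)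
  simp only [Fintype.sum_prod_type] at h
  simp only [trace, diag_apply, mul_apply, transpose_apply]
  rw [Finset.sum_comm (f := fun x y => B x y * B x y)]
  simpa only [sq] using h

/-- Hölder's inequality for the trace of a product of `2 ^ (N + 1)` matrices. -/
lemma trace_dyadicWord_pow_le (N : ℕ) (f : ℕ → Matrix n n ℝ) :
    (dyadicWord (N + 1) f).trace ^ 2 ^ (N + 1)
      ≤ ∏ i ∈ Finset.range (2 ^ (N + 1)), schattenPow N (f i) := by
  induction N generalizing f with
  | zero =>
    simpa [dyadicWord, schattenPow, Finset.prod_range_succ] using trace_mul_sq_le (f 0) (f 1)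
  | succ N ih =>
    -- Pairing neighbours halves the word, so the Schatten norm of a product must be split. By
    -- cyclicity it is the trace of an alternating word in `Aᵀ * A` and `B * Bᵀ`, to which the
    -- induction hypothesis applies again.
    have key (A B : Matrix n n ℝ) :
        schattenPow N (A * B) ^ 2 ≤ schattenPow (N + 1) A * schattenPow (N + 1) B := by
      have h1 : schattenPow N (A * B) = (((Aᵀ * A) * (B * Bᵀ)) ^ 2 ^ N).trace := by
        rw [schattenPow, transpose_mul, show A * B * (Bᵀ * Aᵀ) = A * (B * Bᵀ * Aᵀ) by
          simp only [Matrix.mul_assoc], trace_mul_pow_comm _ _ _ (by positivity),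
          show B * Bᵀ * Aᵀ * A = (B * Bᵀ) * (Aᵀ * A) by simp only [Matrix.mul_assoc],
          trace_mul_pow_comm _ _ _ (by positivity)]
      have h2 := ih (fun i => if i % 2 = 0 then Aᵀ * A else B * Bᵀ)
      rw [dyadicWord_alternating, ← h1, pow_succ' 2 N, prod_range_two_mul] at h2
      have h3 : ∀ i ∈ Finset.range (2 ^ N),
          schattenPow N (if 2 * i % 2 = 0 then Aᵀ * A else B * Bᵀ) *
            schattenPow N (if (2 * i + 1) % 2 = 0 then Aᵀ * A else B * Bᵀ)
          = schattenPow (N + 1) A * schattenPow (N + 1) B := by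
        intro i _
        rw [if_pos (by omega), if_neg (by omega), schattenPow_transpose_mul_self,
          schattenPow_mul_transpose_self]
      rw [Finset.prod_congr rfl h3, Finset.prod_const, Finset.card_range, pow_mul] at h2
      exact le_of_pow_le_pow_left₀ (by positivity)
        (mul_nonneg (schattenPow_nonneg _ _) (schattenPow_nonneg _ _)) h2
    have h := ih (fun i => f (2 * i) * f (2 * i + 1))
    have h0 : 0 ≤ (dyadicWord (N + 2) f).trace ^ 2 ^ (N + 1) :=
      Even.pow_nonneg (by simp [pow_succ]) _
    calc (dyadicWord (N + 1 + 1) f).trace ^ 2 ^ (N + 1 + 1)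
        = ((dyadicWord (N + 2) f).trace ^ 2 ^ (N + 1)) ^ 2 := by rw [← pow_mul, ← pow_succ]
      _ ≤ (∏ i ∈ Finset.range (2 ^ (N + 1)), schattenPow N (f (2 * i) * f (2 * i + 1))) ^ 2 :=
          pow_le_pow_left₀ h0 h 2
      _ = ∏ i ∈ Finset.range (2 ^ (N + 1)), schattenPow N (f (2 * i) * f (2 * i + 1)) ^ 2 :=
          (Finset.prod_pow _ _ _).symm
      _ ≤ _ := by
          rw [pow_succ' 2 (N + 1), prod_range_two_mul]
          exact Finset.prod_le_prod (fun _ _ => sq_nonneg _) fun _ _ => key _ _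

lemma trace_pow_le_schattenPow (N : ℕ) (A : Matrix n n ℝ) :
    (A ^ 2 ^ (N + 1)).trace ≤ schattenPow N A := by
  have h := trace_dyadicWord_pow_le N (fun _ => A)
  rw [dyadicWord_const, Finset.prod_const, Finset.card_range] at h
  refine le_of_pow_le_pow_left₀ (n := 2 ^ (N + 1)) (by positivity) (schattenPow_nonneg _ _) h

/-- Hölder bounds the trace by a Schatten power of `A * B`, which by symmetry and cyclicity is the
trace of a power of `A ^ 2 * B ^ 2` with half the exponent; then iterate on the squares. -/
lemma trace_mul_pow_le (N : ℕ) {A B : Matrix n n ℝ} (hA : A.IsSymm) (hB : B.IsSymm) :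
    ((A * B) ^ 2 ^ N).trace ≤ (A ^ 2 ^ N * B ^ 2 ^ N).trace := by
  induction N generalizing A B with
  | zero => simp
  | succ N ih =>
    calc ((A * B) ^ 2 ^ (N + 1)).trace ≤ schattenPow N (A * B) := trace_pow_le_schattenPow N _
      _ = ((A ^ 2 * B ^ 2) ^ 2 ^ N).trace := by
        rw [schattenPow, transpose_mul, hA.eq, hB.eq,
          show A * B * (B * A) = A * (B ^ 2 * A) by simp only [sq, Matrix.mul_assoc],
          trace_mul_pow_comm _ _ _ (by positivity), Matrix.mul_assoc, ← sq,
          trace_mul_pow_comm _ _ _ (by positivity)]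
      _ ≤ _ := by
        have h := ih (hA.pow 2) (hB.pow 2)
        rwa [← pow_mul, ← pow_mul, ← pow_succ'] at h

end TraceHolder

/-! ### The Lie product formula -/

section Lie

variable {𝔸 : Type*} [NormedRing 𝔸] [NormedAlgebra ℝ 𝔸]

lemma norm_pow_sub_pow_le {𝔸 : Type*} [NormedRing 𝔸] [NormOneClass 𝔸] {x y : 𝔸} {M : ℝ} (hM : 1 ≤ M) (hx : ‖x‖ ≤ M) (hy : ‖y‖ ≤ M) (N : ℕ) :
    ‖x ^ N - y ^ N‖ ≤ N * ‖x - y‖ * M ^ N := by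
  induction N with
  | zero => simp
  | succ N ih =>
    have h : x ^ (N + 1) - y ^ (N + 1) = x ^ N * (x - y) + (x ^ N - y ^ N) * y := by
      rw [pow_succ, pow_succ, mul_sub, sub_mul]; abel
    rw [h]
    have h1 : ‖x ^ N * (x - y)‖ ≤ M ^ (N + 1) * ‖x - y‖ := by
      refine (norm_mul_le _ _).trans (mul_le_mul_of_nonneg_right ?_ (norm_nonneg _))
      exact ((norm_pow_le x N).trans (pow_le_pow_left₀ (norm_nonneg _) hx N)).trans
        (pow_le_pow_right₀ hM N.le_succ)
    have h2 : ‖(x ^ N - y ^ N) * y‖ ≤ N * ‖x - y‖ * M ^ N * M :=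
      (norm_mul_le _ _).trans (mul_le_mul ih hy (norm_nonneg _) (by positivity))
    refine (norm_add_le _ _).trans ((add_le_add h1 h2).trans_eq ?_)
    push_cast
    ring

/-- Both bases have norm at most `1 + K / N`, so their `N`-th powers stay below `exp K`, while
telescoping costs only `N * ‖x N - y N‖`, which tends to zero because the first-order terms agree.
-/
lemma tendsto_pow_sub_pow [NormOneClass 𝔸] {x y : ℕ → 𝔸} {c : 𝔸}
    (hx : Tendsto (fun N : ℕ => (N : ℝ) • (x N - 1)) atTop (𝓝 c))
    (hy : Tendsto (fun N : ℕ => (N : ℝ) • (y N - 1)) atTop (𝓝 c)) :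
    Tendsto (fun N => x N ^ N - y N ^ N) atTop (𝓝 0) := by
  set K := ‖c‖ + 1
  have hb {z : ℕ → 𝔸} (hz : Tendsto (fun N : ℕ => (N : ℝ) • (z N - 1)) atTop (𝓝 c)) :
      ∀ᶠ N : ℕ in atTop, ‖z N‖ ≤ 1 + K / N := by
    filter_upwards [hz.norm.eventually (eventually_lt_nhds (lt_add_one ‖c‖)),
      eventually_gt_atTop 0] with N hN h0
    have h0' : (0 : ℝ) < N := by exact_mod_cast h0
    rw [norm_smul, Real.norm_of_nonneg h0'.le] at hN
    have h1 : ‖z N - 1‖ ≤ K / N := by rw [le_div_iff₀ h0', mul_comm]; exact hN.le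
    calc ‖z N‖ = ‖1 + (z N - 1)‖ := by congr 1; abel
      _ ≤ ‖(1 : 𝔸)‖ + ‖z N - 1‖ := norm_add_le _ _
      _ ≤ 1 + K / N := by rw [norm_one]; gcongr
  have hK : 0 ≤ K := by positivity
  have hd : Tendsto (fun N : ℕ => ‖(N : ℝ) • (x N - 1) - (N : ℝ) • (y N - 1)‖ * Real.exp K) atTop
      (𝓝 0) := by
    simpa using (hx.sub hy).norm.mul_const (Real.exp K)
  refine squeeze_zero_norm' ?_ hd
  filter_upwards [hb hx, hb hy, eventually_gt_atTop 0] with N h1 h2 h0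
  have h0' : (0 : ℝ) < N := by exact_mod_cast h0
  have hM : 1 ≤ 1 + K / N := by simp only [le_add_iff_nonneg_right]; positivity
  refine (norm_pow_sub_pow_le hM h1 h2 N).trans ?_
  rw [← smul_sub, norm_smul, Real.norm_of_nonneg h0'.le, sub_sub_sub_cancel_right]
  gcongr
  calc (1 + K / N) ^ N ≤ Real.exp (K / N) ^ N := by
        gcongr
        rw [add_comm]
        exact Real.add_one_le_exp _
    _ = Real.exp K := by
        rw [← Real.exp_nat_mul]
        congr 1
        field_simp

lemma tendsto_nat_smul_of_hasDerivAt {f : ℝ → 𝔸} {c : 𝔸} (hf : HasDerivAt f c 0) (h0 : f 0 = 1) :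
    Tendsto (fun N : ℕ => (N : ℝ) • (f (N : ℝ)⁻¹ - 1)) atTop (𝓝 c) := by
  have h := hf.tendsto_slope
  have hn : Tendsto (fun N : ℕ => (N : ℝ)⁻¹) atTop (𝓝[≠] 0) := by
    refine tendsto_nhdsWithin_iff.mpr ⟨tendsto_inv_atTop_nhds_zero_nat, ?_⟩
    filter_upwards [eventually_gt_atTop 0] with N hN
    simpa using hN.ne'
  refine (h.comp hn).congr fun N => ?_
  simp [slope_def_module, h0]

/-- The **Lie product formula**. -/
theorem tendsto_exp_mul_exp_pow [NormOneClass 𝔸] [CompleteSpace 𝔸] (a b : 𝔸) :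
    Tendsto (fun N : ℕ => (NormedSpace.exp ((N : ℝ)⁻¹ • a) * NormedSpace.exp ((N : ℝ)⁻¹ • b)) ^ N)
      atTop (𝓝 (NormedSpace.exp (a + b))) := by
  have hexp (x : 𝔸) : HasDerivAt (fun t : ℝ => NormedSpace.exp (t • x)) x 0 := by
    simpa using hasDerivAt_exp_smul_const (𝕂 := ℝ) x (0 : ℝ)
  have h1 := tendsto_nat_smul_of_hasDerivAt (hexp (a + b)) (by simp)
  have h2 := tendsto_nat_smul_of_hasDerivAt
    (f := fun t : ℝ => NormedSpace.exp (t • a) * NormedSpace.exp (t • b)) (c := a + b)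
    (by have h := (hexp a).mul (hexp b); simp only [zero_smul, NormedSpace.exp_zero, mul_one, one_mul] at h; exact h) (by simp)
  have h3 := (tendsto_pow_sub_pow h2 h1).add_const (NormedSpace.exp (a + b))
  rw [zero_add] at h3
  refine h3.congr' ?_
  filter_upwards [eventually_gt_atTop 0] with N hN
  let : NormedAlgebra ℚ 𝔸 := NormedAlgebra.restrictScalars ℚ ℝ 𝔸
  have : NormedSpace.exp ((N : ℝ)⁻¹ • (a + b)) ^ N = NormedSpace.exp (a + b) := by
    rw [← NormedSpace.exp_nsmul, ← Nat.cast_smul_eq_nsmul ℝ, smul_smul,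
      mul_inv_cancel₀ (by exact_mod_cast hN.ne'), one_smul]
  rw [this, sub_add_cancel]

end Lie

/-! ### The Golden–Thompson inequality -/

section GoldenThompson

variable {n : Type*} [Fintype n] [DecidableEq n]

open scoped Matrix.Norms.Operator in
theorem _root_.Matrix.tendsto_exp_mul_exp_pow [Nonempty n] (A B : Matrix n n ℝ) :
    Tendsto (fun N : ℕ => (NormedSpace.exp ((N : ℝ)⁻¹ • A) * NormedSpace.exp ((N : ℝ)⁻¹ • B)) ^ N)
      atTop (𝓝 (NormedSpace.exp (A + B))) :=
  JointTail.tendsto_exp_mul_exp_pow A B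

/-- The **Golden–Thompson inequality** for real symmetric matrices. -/
theorem trace_exp_add_le [Nonempty n] {A B : Matrix n n ℝ} (hA : A.IsSymm) (hB : B.IsSymm) :
    (NormedSpace.exp (A + B)).trace ≤ (NormedSpace.exp A * NormedSpace.exp B).trace := by
  -- Only the subsequence of exponents `2 ^ N` is used, since the trace inequality covers powers of
  -- two.
  have h := (Matrix.tendsto_exp_mul_exp_pow A B).comp
    (tendsto_pow_atTop_atTop_of_one_lt (r := 2) one_lt_two)
  have ht := (continuous_id.matrix_trace.tendsto (NormedSpace.exp (A + B))).comp h
  refine le_of_tendsto ht (Eventually.of_forall fun N => ?_)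
  have key (C : Matrix n n ℝ) :
      NormedSpace.exp (((2 ^ N : ℕ) : ℝ)⁻¹ • C) ^ 2 ^ N = NormedSpace.exp C := by
    rw [← Matrix.exp_nsmul, ← Nat.cast_smul_eq_nsmul ℝ, smul_smul,
      mul_inv_cancel₀ (by positivity), one_smul]
  have h := trace_mul_pow_le N (A := NormedSpace.exp (((2 ^ N : ℕ) : ℝ)⁻¹ • A))
    (B := NormedSpace.exp (((2 ^ N : ℕ) : ℝ)⁻¹ • B)) (hA.smul _).exp (hB.smul _).exp
  rwa [key, key] at h

end GoldenThompson

/-! ### Trace estimates in an eigenbasis -/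

section Spectral

variable {n : Type*} [Fintype n] [DecidableEq n]

lemma exists_orthogonal_diagonal {M : Matrix n n ℝ} (hM : M.IsHermitian) :
    ∃ U : Matrix n n ℝ, U * Uᵀ = 1 ∧ Uᵀ * U = 1 ∧ M = U * diagonal hM.eigenvalues * Uᵀ ∧
      ∀ t : ℝ, NormedSpace.exp (t • M)
        = U * diagonal (fun i => Real.exp (t * hM.eigenvalues i)) * Uᵀ := by
  have hU := Unitary.coe_mul_star_self hM.eigenvectorUnitary
  have hU' := Unitary.coe_star_mul_self hM.eigenvectorUnitary
  have hs := hM.spectral_theorem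
  rw [Unitary.conjStarAlgAut_apply] at hs
  set U := (hM.eigenvectorUnitary : Matrix n n ℝ)
  have hst : star U = Uᵀ := conjTranspose_eq_transpose_of_trivial U
  change U * star U = 1 at hU
  rw [hst] at hU hU' hs
  have hs' : M = U * diagonal hM.eigenvalues * Uᵀ := hs
  refine ⟨U, hU, hU', hs', fun t => ?_⟩
  have hinv : U⁻¹ = Uᵀ := Matrix.inv_eq_right_inv hU
  have h1 : t • M = U * diagonal (fun i => t * hM.eigenvalues i) * U⁻¹ := by
    rw [hinv]
    conv_lhs => rw [hs']
    rw [← Matrix.smul_mul, ← Matrix.mul_smul, ← diagonal_smul]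
    rfl
  rw [h1, Matrix.exp_conj _ _ (IsUnit.of_mul_eq_one _ hU), Matrix.exp_diagonal, hinv]
  congr 3
  funext i
  rw [Pi.coe_exp, Real.exp_eq_exp_ℝ]

lemma trace_mul_orthogonal_diagonal (D U : Matrix n n ℝ) (d : n → ℝ) :
    (D * (U * diagonal d * Uᵀ)).trace = ∑ i, d i * (Uᵀ * D * U) i i := by
  rw [show D * (U * diagonal d * Uᵀ) = (D * U * diagonal d) * Uᵀ by
    simp only [Matrix.mul_assoc], Matrix.trace_mul_comm,
    show Uᵀ * (D * U * diagonal d) = Uᵀ * D * U * diagonal d by simp only [Matrix.mul_assoc]]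
  simp only [trace, diag_apply, mul_diagonal]
  exact Finset.sum_congr rfl fun i _ => mul_comm _ _

/-- The diagonal of a positive semidefinite `D` in an eigenbasis of the symmetric matrix `M`. -/
lemma exists_weights {M D : Matrix n n ℝ} (hM : M.IsHermitian) (hD : D.PosSemidef) :
    ∃ w : n → ℝ, (∀ i, 0 ≤ w i) ∧ D.trace = ∑ i, w i ∧
      (D * M).trace = ∑ i, hM.eigenvalues i * w i ∧
      ∀ t : ℝ, (D * NormedSpace.exp (t • M)).trace
        = ∑ i, Real.exp (t * hM.eigenvalues i) * w i := by
  obtain ⟨U, hU, -, hs, he⟩ := exists_orthogonal_diagonal hM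
  have hP : (Uᵀ * D * U).PosSemidef := by
    have := hD.conjTranspose_mul_mul_same U
    rwa [conjTranspose_eq_transpose_of_trivial] at this
  refine ⟨fun i => (Uᵀ * D * U) i i, fun i => hP.diag_nonneg, ?_, ?_, fun t => ?_⟩
  · change D.trace = (Uᵀ * D * U).trace
    rw [Matrix.mul_assoc, Matrix.trace_mul_comm, Matrix.mul_assoc, hU, Matrix.mul_one]
  · rw [← trace_mul_orthogonal_diagonal, ← hs]
  · rw [he, trace_mul_orthogonal_diagonal]

lemma trace_mul_nonneg {C D : Matrix n n ℝ} (hC : C.PosSemidef) (hD : D.PosSemidef) :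
    0 ≤ (C * D).trace := by
  obtain ⟨w, hw, -, h, -⟩ := exists_weights hD.1 hC
  rw [h]
  exact Finset.sum_nonneg fun i _ => mul_nonneg (hD.eigenvalues_nonneg i) (hw i)

lemma posSemidef_exp {M : Matrix n n ℝ} (hM : M.IsHermitian) :
    (NormedSpace.exp M).PosSemidef := by
  obtain ⟨U, -, -, -, he⟩ := exists_orthogonal_diagonal hM
  have h := he 1
  rw [one_smul] at h
  have hd : (diagonal fun i => Real.exp (1 * hM.eigenvalues i)).PosSemidef :=
    PosSemidef.diagonal fun i => (Real.exp_pos _).le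
  have := hd.mul_mul_conjTranspose_same U
  rwa [conjTranspose_eq_transpose_of_trivial, ← h] at this

lemma exp_le_trace_exp {M : Matrix n n ℝ} (hM : M.IsHermitian) {l : ℝ} (hl : l ∈ spectrum ℝ M)
    (t : ℝ) : Real.exp (t * l) ≤ (NormedSpace.exp (t • M)).trace := by
  rw [hM.spectrum_real_eq_range_eigenvalues] at hl
  obtain ⟨i, rfl⟩ := hl
  obtain ⟨U, -, hU, -, he⟩ := exists_orthogonal_diagonal hM
  rw [he, Matrix.mul_assoc, Matrix.trace_mul_comm, Matrix.mul_assoc, hU, Matrix.mul_one,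
    trace_diagonal]
  exact Finset.single_le_sum (f := fun i => Real.exp (t * hM.eigenvalues i))
    (fun j _ => (Real.exp_pos _).le) (Finset.mem_univ i)

lemma eigenvalues_le_trace {X : Matrix n n ℝ} (hX : X.PosSemidef) (i : n) :
    hX.1.eigenvalues i ≤ X.trace := by
  have htr : X.trace = ∑ i, hX.1.eigenvalues i := by
    simpa using hX.1.trace_eq_sum_eigenvalues
  rw [htr]
  exact Finset.single_le_sum (f := hX.1.eigenvalues) (fun j _ => hX.eigenvalues_nonneg j)
    (Finset.mem_univ i)

lemma trace_mul_le_trace {X C : Matrix n n ℝ} (hX : X.PosSemidef) (hX1 : X.trace ≤ 1)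
    (hC : C.PosSemidef) : (C * X).trace ≤ C.trace := by
  obtain ⟨w, hw, h1, h2, -⟩ := exists_weights hX.1 hC
  rw [h1, h2]
  exact Finset.sum_le_sum fun i _ =>
    mul_le_of_le_one_left (hw i) ((eigenvalues_le_trace hX i).trans hX1)

/-- For `0 ≤ X` of trace at most one, `exp (t X) ≤ 1 + (exp t - 1) X`, tested against `C`. -/
lemma trace_mul_exp_smul_le {X C : Matrix n n ℝ} (hX : X.PosSemidef) (hX1 : X.trace ≤ 1)
    (hC : C.PosSemidef) (t : ℝ) :
    (C * NormedSpace.exp (t • X)).trace ≤ C.trace + (Real.exp t - 1) * (C * X).trace := by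
  obtain ⟨w, hw, h1, h2, h3⟩ := exists_weights hX.1 hC
  rw [h1, h2, h3, Finset.mul_sum, ← Finset.sum_add_distrib]
  refine Finset.sum_le_sum fun i _ => ?_
  have hl0 := hX.eigenvalues_nonneg i
  have hl1 := (eigenvalues_le_trace hX i).trans hX1
  set l := hX.1.eigenvalues i
  -- The chord of `exp` between `0` and `t` lies above the graph at `l * t`; this needs `l` in `[0,
  -- 1]` but no sign of `t`.
  have hc := convexOn_exp.2 (Set.mem_univ 0) (Set.mem_univ t) (sub_nonneg.2 hl1) hl0
    (sub_add_cancel 1 l)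
  simp only [smul_eq_mul, mul_zero, zero_add, Real.exp_zero, mul_one] at hc
  rw [mul_comm t l]
  nlinarith [mul_le_mul_of_nonneg_right hc (hw i)]

lemma trace_mul_le_of_spectrum_le {M D : Matrix n n ℝ} (hM : M.IsHermitian) (hD : D.PosSemidef)
    {b : ℝ} (hb : ∀ l ∈ spectrum ℝ M, l ≤ b) : (D * M).trace ≤ b * D.trace := by
  obtain ⟨w, hw, h1, h2, -⟩ := exists_weights hM hD
  rw [h1, h2, Finset.mul_sum]
  exact Finset.sum_le_sum fun i _ =>
    mul_le_mul_of_nonneg_right (hb _ (hM.eigenvalues_mem_spectrum_real i)) (hw i)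

lemma le_trace_mul_of_le_spectrum {M D : Matrix n n ℝ} (hM : M.IsHermitian) (hD : D.PosSemidef)
    {b : ℝ} (hb : ∀ l ∈ spectrum ℝ M, b ≤ l) : b * D.trace ≤ (D * M).trace := by
  obtain ⟨w, hw, h1, h2, -⟩ := exists_weights hM hD
  rw [h1, h2, Finset.mul_sum]
  exact Finset.sum_le_sum fun i _ =>
    mul_le_mul_of_nonneg_right (hb _ (hM.eigenvalues_mem_spectrum_real i)) (hw i)

end Spectral

/-! ### Extreme eigenvalues and singular values -/

section Extreme

variable {k : ℕ}

lemma le_eigMax {M : Matrix (Fin k) (Fin k) ℝ} : ∀ l ∈ spectrum ℝ M, l ≤ eigMax M :=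
  fun _ hl => le_csSup M.finite_real_spectrum.bddAbove hl

lemma eigMin_le {M : Matrix (Fin k) (Fin k) ℝ} : ∀ l ∈ spectrum ℝ M, eigMin M ≤ l :=
  fun _ hl => csInf_le M.finite_real_spectrum.bddBelow hl

lemma sq_singularValues_mem_spectrum {m : ℕ} (B : Matrix (Fin m) (Fin k) ℝ) {j : ℕ} (hj : j < k) :
    (Matrix.toEuclideanLin B).singularValues j ^ 2 ∈ spectrum ℝ (Bᵀ * B) := by
  have h := (Matrix.toEuclideanLin B).hasEigenvalue_adjoint_comp_self_sq_singularValues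
    (n := j) (by simpa using hj)
  have h2 := h.mem_spectrum
  rw [← Matrix.toEuclideanLin_conjTranspose_eq_adjoint, conjTranspose_eq_transpose_of_trivial] at h2
  have hcomp : Matrix.toEuclideanLin (Bᵀ * B)
      = Matrix.toEuclideanLin Bᵀ ∘ₗ Matrix.toEuclideanLin B := by
    ext v : 1
    simp [Matrix.toLpLin_apply]
  rw [← hcomp] at h2
  rw [← Matrix.spectrum_toLpLin 2]
  exact h2

end Extreme

/-! ### The joint matrix Laplace transform -/

section LaplaceTransform

/-- Tonelli on the product law: one may freeze `U` and integrate over `V` alone. -/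
lemma lintegral_le_of_indepFun {Ω α β : Type*} [MeasurableSpace Ω] [MeasurableSpace α]
    [MeasurableSpace β] {μ : Measure Ω} [IsProbabilityMeasure μ] {U : Ω → α} {V : Ω → β}
    (hU : Measurable U) (hV : Measurable V) (h : IndepFun U V μ) {F : α × β → ℝ≥0∞}
    (hF : Measurable F) {G : Ω → ℝ≥0∞}
    (hFG : ∀ ω₀, ∫⁻ ω, F (U ω₀, V ω) ∂μ ≤ G ω₀) :
    ∫⁻ ω, F (U ω, V ω) ∂μ ≤ ∫⁻ ω, G ω ∂μ := by
  have := Measure.isProbabilityMeasure_map (μ := μ) hV.aemeasurable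
  calc ∫⁻ ω, F (U ω, V ω) ∂μ = ∫⁻ p, F p ∂(μ.map fun ω => (U ω, V ω)) :=
        (lintegral_map hF (hU.prodMk hV)).symm
    _ = ∫⁻ p, F p ∂((μ.map U).prod (μ.map V)) := by
        rw [h.map_prod_eq_prod_map_map hU.aemeasurable hV.aemeasurable]
    _ = ∫⁻ a, ∫⁻ b, F (a, b) ∂(μ.map V) ∂(μ.map U) := lintegral_prod _ hF.aemeasurable
    _ = ∫⁻ ω₀, ∫⁻ b, F (U ω₀, b) ∂(μ.map V) ∂μ :=
        lintegral_map hF.lintegral_prod_right' hU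
    _ = ∫⁻ ω₀, ∫⁻ ω, F (U ω₀, V ω) ∂μ ∂μ :=
        lintegral_congr fun ω₀ => lintegral_map (hF.comp measurable_prodMk_left) hV
    _ ≤ _ := lintegral_mono hFG

variable {n : Type*} [Fintype n] [DecidableEq n]

open scoped Matrix.Norms.Operator in
lemma _root_.Matrix.continuous_exp : Continuous (NormedSpace.exp : Matrix n n ℝ → Matrix n n ℝ) :=
  NormedSpace.exp_continuous

lemma continuous_trace_exp (t : ℝ) :
    Continuous fun M : n → n → ℝ => (NormedSpace.exp (t • (Matrix.of M))).trace := by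
  have h : Continuous fun M : n → n → ℝ => t • (Matrix.of M : Matrix n n ℝ) :=
    (continuous_id (X := n → n → ℝ)).const_smul t
  exact (Matrix.continuous_exp.comp h).matrix_trace

/-- A pair of matrices, as a pair of functions of their indices. -/
def entryPair (X Y : Matrix n n ℝ) : (n → n → ℝ) × (n → n → ℝ) :=
  (fun i j => X i j, fun i j => Y i j)

variable {Ω : Type*} [MeasurableSpace Ω] {μ : Measure Ω}

instance measurableAdd₂_prod {α β : Type*} [MeasurableSpace α] [MeasurableSpace β] [Add α] [Add β]
    [MeasurableAdd₂ α] [MeasurableAdd₂ β] : MeasurableAdd₂ (α × β) :=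
  ⟨(measurable_fst.fst.add measurable_snd.fst).prodMk (measurable_fst.snd.add measurable_snd.snd)⟩

lemma measurable_and_norm_trace_mul_le {X : Ω → Matrix n n ℝ} {C : Matrix n n ℝ}
    (hXm : ∀ i j, Measurable fun ω => X ω i j) (hX : ∀ ω, (X ω).PosSemidef)
    (hX1 : ∀ᵐ ω ∂μ, (X ω).trace ≤ 1) (hC : C.PosSemidef) :
    Measurable (fun ω => (C * X ω).trace) ∧ ∀ᵐ ω ∂μ, ‖(C * X ω).trace‖ ≤ C.trace := by
  refine ⟨?_, ?_⟩
  · simp only [trace, diag_apply, mul_apply]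
    fun_prop
  · filter_upwards [hX1] with ω h
    rw [Real.norm_of_nonneg (trace_mul_nonneg hC (hX ω))]
    exact trace_mul_le_trace (hX ω) h hC

/-- The estimate for a single row. The first-moment hypotheses carry the factor `exp t - 1`, whose
sign decides whether they bound the mean from above or from below, so both tails are covered. -/
lemma lintegral_trace_mul_exp_le [IsProbabilityMeasure μ] {X Y : Ω → Matrix n n ℝ} {t τ τq : ℝ}
    (hXm : ∀ i j, Measurable fun ω => X ω i j) (hYm : ∀ i j, Measurable fun ω => Y ω i j)
    (hX : ∀ ω, (X ω).PosSemidef) (hY : ∀ ω, (Y ω).PosSemidef)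
    (hX1 : ∀ᵐ ω ∂μ, (X ω).trace ≤ 1) (hY1 : ∀ᵐ ω ∂μ, (Y ω).trace ≤ 1)
    (hτX : ∀ C : Matrix n n ℝ, C.PosSemidef →
      (Real.exp t - 1) * ∫ ω, (C * X ω).trace ∂μ ≤ (Real.exp t - 1) * (τ * C.trace))
    (hτY : ∀ C : Matrix n n ℝ, C.PosSemidef →
      (Real.exp t - 1) * ∫ ω, (C * Y ω).trace ∂μ ≤ (Real.exp t - 1) * (τ * C.trace))
    (hτq : ∀ C D : Matrix n n ℝ, C.PosSemidef → D.PosSemidef →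
      ∫ ω, (C * X ω).trace * (D * Y ω).trace ∂μ ≤ τq * (C.trace * D.trace))
    {C D : Matrix n n ℝ} (hC : C.PosSemidef) (hD : D.PosSemidef) :
    ∫⁻ ω, ENNReal.ofReal ((C * NormedSpace.exp (t • X ω)).trace *
        (D * NormedSpace.exp (t • Y ω)).trace) ∂μ
      ≤ ENNReal.ofReal ((1 + 2 * (Real.exp t - 1) * τ + (Real.exp t - 1) ^ 2 * τq) *
        (C.trace * D.trace)) := by
  set s := Real.exp t - 1
  obtain ⟨hpm, hpb⟩ := measurable_and_norm_trace_mul_le hXm hX hX1 hC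
  obtain ⟨hqm, hqb⟩ := measurable_and_norm_trace_mul_le hYm hY hY1 hD
  have hpi : Integrable (fun ω => (C * X ω).trace) μ :=
    Integrable.of_bound hpm.aestronglyMeasurable _ hpb
  have hqi : Integrable (fun ω => (D * Y ω).trace) μ :=
    Integrable.of_bound hqm.aestronglyMeasurable _ hqb
  have hpq : Integrable (fun ω => (C * X ω).trace * (D * Y ω).trace) μ :=
    hqi.bdd_mul hpm.aestronglyMeasurable hpb
  have hexpX (ω) : 0 ≤ (C * NormedSpace.exp (t • X ω)).trace :=
    trace_mul_nonneg hC (posSemidef_exp ((hX ω).1.smul (IsSelfAdjoint.all t)))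
  have hexpY (ω) : 0 ≤ (D * NormedSpace.exp (t • Y ω)).trace :=
    trace_mul_nonneg hD (posSemidef_exp ((hY ω).1.smul (IsSelfAdjoint.all t)))
  have hle : ∀ᵐ ω ∂μ, (C * NormedSpace.exp (t • X ω)).trace *
      (D * NormedSpace.exp (t • Y ω)).trace
        ≤ (C.trace + s * (C * X ω).trace) * (D.trace + s * (D * Y ω).trace) := by
    filter_upwards [hX1, hY1] with ω h1 h2
    have hx := trace_mul_exp_smul_le (hX ω) h1 hC t
    exact mul_le_mul hx (trace_mul_exp_smul_le (hY ω) h2 hD t) (hexpY ω) ((hexpX ω).trans hx)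
  have hexpand : (fun ω => (C.trace + s * (C * X ω).trace) * (D.trace + s * (D * Y ω).trace))
      = fun ω => C.trace * D.trace + (s * D.trace) * (C * X ω).trace +
        (s * C.trace) * (D * Y ω).trace + s ^ 2 * ((C * X ω).trace * (D * Y ω).trace) := by
    funext ω; ring
  have hi1 : Integrable (fun ω => C.trace * D.trace + (s * D.trace) * (C * X ω).trace) μ :=
    (integrable_const _).add (hpi.const_mul _)
  have hi2 : Integrable (fun ω => C.trace * D.trace + (s * D.trace) * (C * X ω).trace +
      (s * C.trace) * (D * Y ω).trace) μ :=
    hi1.add (hqi.const_mul _)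
  have hint : Integrable
      (fun ω => (C.trace + s * (C * X ω).trace) * (D.trace + s * (D * Y ω).trace)) μ := by
    rw [hexpand]
    exact hi2.add (hpq.const_mul _)
  have heq : ∫ ω, (C.trace + s * (C * X ω).trace) * (D.trace + s * (D * Y ω).trace) ∂μ
      = C.trace * D.trace + D.trace * (s * ∫ ω, (C * X ω).trace ∂μ)
        + C.trace * (s * ∫ ω, (D * Y ω).trace ∂μ)
        + s ^ 2 * ∫ ω, (C * X ω).trace * (D * Y ω).trace ∂μ := by
    rw [hexpand, integral_add hi2 (hpq.const_mul _), integral_add hi1 (hqi.const_mul _),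
      integral_add (integrable_const _) (hpi.const_mul _),
      integral_const, integral_const_mul, integral_const_mul, integral_const_mul]
    simp only [probReal_univ, one_smul]
    ring
  calc _ ≤ ∫⁻ ω, ENNReal.ofReal
        ((C.trace + s * (C * X ω).trace) * (D.trace + s * (D * Y ω).trace)) ∂μ :=
        lintegral_mono_ae (hle.mono fun ω h => ENNReal.ofReal_le_ofReal h)
    _ = ENNReal.ofReal (∫ ω,
        (C.trace + s * (C * X ω).trace) * (D.trace + s * (D * Y ω).trace) ∂μ) :=
        (ofReal_integral_eq_lintegral_ofReal hint
          (hle.mono fun ω h => (mul_nonneg (hexpX ω) (hexpY ω)).trans h)).symm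
    _ ≤ _ := by
        refine ENNReal.ofReal_le_ofReal ?_
        rw [heq]
        have h1 := mul_le_mul_of_nonneg_left (hτX C hC) hD.trace_nonneg
        have h2 := mul_le_mul_of_nonneg_left (hτY D hD) hC.trace_nonneg
        have h3 := mul_le_mul_of_nonneg_left (hτq C D hC hD) (sq_nonneg s)
        nlinarith [h1, h2, h3]

/-- The joint Laplace transform bound for sums of independent, identically distributed pairs of
positive semidefinite matrices. -/
theorem lintegral_trace_exp_sum_le [IsProbabilityMeasure μ] [Nonempty n] {ι : Type*} [DecidableEq ι]
    {X Y : ι → Ω → Matrix n n ℝ} {t τ τq : ℝ} (r₀ : ι)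
    (hXm : ∀ r i j, Measurable fun ω => X r ω i j) (hYm : ∀ r i j, Measurable fun ω => Y r ω i j)
    (hX : ∀ r ω, (X r ω).PosSemidef) (hY : ∀ r ω, (Y r ω).PosSemidef)
    (hind : iIndepFun (fun r ω => entryPair (X r ω) (Y r ω)) μ)
    (hid : ∀ r, IdentDistrib (fun ω => entryPair (X r ω) (Y r ω))
      (fun ω => entryPair (X r₀ ω) (Y r₀ ω)) μ μ)
    (hX1 : ∀ᵐ ω ∂μ, (X r₀ ω).trace ≤ 1) (hY1 : ∀ᵐ ω ∂μ, (Y r₀ ω).trace ≤ 1)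
    (hτX : ∀ C : Matrix n n ℝ, C.PosSemidef →
      (Real.exp t - 1) * ∫ ω, (C * X r₀ ω).trace ∂μ ≤ (Real.exp t - 1) * (τ * C.trace))
    (hτY : ∀ C : Matrix n n ℝ, C.PosSemidef →
      (Real.exp t - 1) * ∫ ω, (C * Y r₀ ω).trace ∂μ ≤ (Real.exp t - 1) * (τ * C.trace))
    (hτq : ∀ C D : Matrix n n ℝ, C.PosSemidef → D.PosSemidef →
      ∫ ω, (C * X r₀ ω).trace * (D * Y r₀ ω).trace ∂μ ≤ τq * (C.trace * D.trace))
    (hg : 0 ≤ 1 + 2 * (Real.exp t - 1) * τ + (Real.exp t - 1) ^ 2 * τq) (s : Finset ι) :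
    ∫⁻ ω, ENNReal.ofReal ((NormedSpace.exp (t • ∑ r ∈ s, X r ω)).trace *
        (NormedSpace.exp (t • ∑ r ∈ s, Y r ω)).trace) ∂μ
      ≤ ENNReal.ofReal ((1 + 2 * (Real.exp t - 1) * τ + (Real.exp t - 1) ^ 2 * τq) ^ s.card *
        (Fintype.card n : ℝ) ^ 2) := by
  set g := 1 + 2 * (Real.exp t - 1) * τ + (Real.exp t - 1) ^ 2 * τq
  induction s using Finset.induction_on with
  -- Each trace of `exp 0` is the dimension; this produces the prefactor `k ^ 2`.
  | empty => simp [sq]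
  | insert r s hr ih =>
    set F : ((n → n → ℝ) × (n → n → ℝ)) × ((n → n → ℝ) × (n → n → ℝ)) → ℝ≥0∞ := fun p =>
      ENNReal.ofReal ((NormedSpace.exp (t • (Matrix.of (p.1.1 + p.2.1)))).trace *
        (NormedSpace.exp (t • (Matrix.of (p.1.2 + p.2.2)))).trace) with hF
    have hFm : Measurable F := by
      refine ENNReal.measurable_ofReal.comp (Measurable.mul ?_ ?_)
      · exact (continuous_trace_exp t).measurable.comp
          (measurable_fst.fst.add measurable_snd.fst)
      · exact (continuous_trace_exp t).measurable.comp
          (measurable_fst.snd.add measurable_snd.snd)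
    have hZm (r : ι) : Measurable fun ω => entryPair (X r ω) (Y r ω) := by
      refine Measurable.prodMk ?_ ?_
      · exact measurable_pi_lambda _ fun i => measurable_pi_lambda _ fun j => hXm r i j
      · exact measurable_pi_lambda _ fun i => measurable_pi_lambda _ fun j => hYm r i j
    have hUV := hind.indepFun_finsetSum_of_notMem hZm hr
    have hsum (ω : Ω) : (∑ j ∈ s, fun ω => entryPair (X j ω) (Y j ω)) ω
        = entryPair (∑ j ∈ s, X j ω) (∑ j ∈ s, Y j ω) := by
      rw [Finset.sum_apply]
      refine Prod.ext ?_ ?_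
      · rw [Prod.fst_sum]
        funext i j
        simp [entryPair, Matrix.sum_apply, Finset.sum_apply]
      · rw [Prod.snd_sum]
        funext i j
        simp [entryPair, Matrix.sum_apply, Finset.sum_apply]
    have hsX (ω : Ω) : (∑ j ∈ s, X j ω).PosSemidef := posSemidef_sum _ fun j _ => hX j ω
    have hsY (ω : Ω) : (∑ j ∈ s, Y j ω).PosSemidef := posSemidef_sum _ fun j _ => hY j ω
    have hsmul {M : Matrix n n ℝ} (hM : M.PosSemidef) : (t • M).IsHermitian :=
      hM.1.smul (IsSelfAdjoint.all t)
    have hUm : Measurable (∑ j ∈ s, fun ω => entryPair (X j ω) (Y j ω)) := by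
      simpa only [Finset.sum_fn] using Finset.measurable_sum s fun j _ => hZm j
    have hstep := lintegral_le_of_indepFun hUm (hZm r) hUV
      hFm (G := fun ω => ENNReal.ofReal (g * ((NormedSpace.exp (t • ∑ r ∈ s, X r ω)).trace *
        (NormedSpace.exp (t • ∑ r ∈ s, Y r ω)).trace))) ?_
    · refine le_trans (le_of_eq ?_) (hstep.trans ?_)
      · refine lintegral_congr fun ω => ?_
        rw [hsum, Finset.sum_insert hr, Finset.sum_insert hr, add_comm (X r ω), add_comm (Y r ω)]
        rfl
      · simp_rw [ENNReal.ofReal_mul hg]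
        rw [lintegral_const_mul' _ _ ENNReal.ofReal_ne_top, Finset.card_insert_of_notMem hr,
          pow_succ', mul_assoc, ENNReal.ofReal_mul hg]
        gcongr
    · intro ω₀
      -- With the earlier rows frozen, row `r` may be replaced by the reference row `r₀`, the only
      -- one whose moments are assumed.
      have hid' : ∫⁻ ω, F ((∑ j ∈ s, fun ω => entryPair (X j ω) (Y j ω)) ω₀,
            entryPair (X r ω) (Y r ω)) ∂μ
          = ∫⁻ ω, F ((∑ j ∈ s, fun ω => entryPair (X j ω) (Y j ω)) ω₀,
            entryPair (X r₀ ω) (Y r₀ ω)) ∂μ :=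
        ((hid r).comp (hFm.comp measurable_prodMk_left)).lintegral_eq
      rw [hid', hsum]
      refine le_trans (lintegral_mono fun ω => ENNReal.ofReal_le_ofReal ?_)
        (lintegral_trace_mul_exp_le (hXm r₀) (hYm r₀) (hX r₀) (hY r₀) hX1 hY1 hτX hτY hτq
          (posSemidef_exp (hsmul (hsX ω₀))) (posSemidef_exp (hsmul (hsY ω₀))))
      have hGT {M N : Matrix n n ℝ} (hM : M.PosSemidef) (hN : N.PosSemidef) :
          (NormedSpace.exp (t • (M + N))).trace
            ≤ (NormedSpace.exp (t • M) * NormedSpace.exp (t • N)).trace := by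
        rw [smul_add]
        exact trace_exp_add_le (by simpa using hsmul hM) (by simpa using hsmul hN)
      exact mul_le_mul (hGT (hsX ω₀) (hX r₀ ω)) (hGT (hsY ω₀) (hY r₀ ω))
        (posSemidef_exp (hsmul ((hsY ω₀).add (hY r₀ ω)))).trace_nonneg
        (trace_mul_nonneg (posSemidef_exp (hsmul (hsX ω₀))) (posSemidef_exp (hsmul (hX r₀ ω))))

end LaplaceTransform

/-! ### Markov's inequality for the product of traces -/

section Tail

variable {n : Type*} [Fintype n] [DecidableEq n] {Ω : Type*} [MeasurableSpace Ω] {μ : Measure Ω}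

lemma measurable_trace_exp {M : Ω → Matrix n n ℝ} (hM : ∀ i j, Measurable fun ω => M ω i j)
    (t : ℝ) : Measurable fun ω => (NormedSpace.exp (t • M ω)).trace :=
  (continuous_trace_exp t).measurable.comp (g := fun M : n → n → ℝ =>
    (NormedSpace.exp (t • (Matrix.of M))).trace)
    (measurable_pi_lambda _ fun i => measurable_pi_lambda _ fun j => hM i j)

lemma measureReal_le_of_lintegral_trace_exp_le {M N : Ω → Matrix n n ℝ}
    (hMm : ∀ i j, Measurable fun ω => M ω i j) (hNm : ∀ i j, Measurable fun ω => N ω i j)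
    {t b G : ℝ} (hG : 0 ≤ G)
    (h : ∫⁻ ω, ENNReal.ofReal ((NormedSpace.exp (t • M ω)).trace *
        (NormedSpace.exp (t • N ω)).trace) ∂μ ≤ ENNReal.ofReal G) {E : Set Ω}
    (hE : ∀ ω ∈ E, Real.exp (t * b) ≤ (NormedSpace.exp (t • M ω)).trace ∧
      Real.exp (t * b) ≤ (NormedSpace.exp (t • N ω)).trace) :
    μ.real E ≤ G * Real.exp (-(2 * (t * b))) := by
  have hmark := mul_meas_ge_le_lintegral (μ := μ)
    (((measurable_trace_exp hMm t).mul (measurable_trace_exp hNm t)).ennreal_ofReal)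
    (ENNReal.ofReal (Real.exp (2 * (t * b))))
  have hsub : E ⊆ {ω | ENNReal.ofReal (Real.exp (2 * (t * b))) ≤
      ENNReal.ofReal ((NormedSpace.exp (t • M ω)).trace *
        (NormedSpace.exp (t • N ω)).trace)} := by
    intro ω hω
    obtain ⟨h1, h2⟩ := hE ω hω
    refine ENNReal.ofReal_le_ofReal ?_
    rw [two_mul, Real.exp_add]
    exact mul_le_mul h1 h2 (Real.exp_pos _).le ((Real.exp_pos _).le.trans h1)
  have h1 : ENNReal.ofReal (Real.exp (2 * (t * b))) * μ E ≤ ENNReal.ofReal G :=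
    (mul_le_mul_right (measure_mono hsub) _).trans (hmark.trans h)
  have h2 := ENNReal.toReal_mono ENNReal.ofReal_ne_top h1
  rw [ENNReal.toReal_mul, ENNReal.toReal_ofReal (Real.exp_pos _).le, ENNReal.toReal_ofReal hG]
    at h2
  rw [Real.exp_neg, ← div_eq_mul_inv, le_div_iff₀ (Real.exp_pos _), mul_comm]
  exact h2

end Tail

/-! ### The optimal Laplace parameter -/

section Scalar

/-- The quadratic is the stationarity condition for the Laplace exponent, and `c4` is its
nonnegative root. -/
lemma c4_nonneg_and_quadratic {a : ℝ} {k : ℕ} {c₁ c₂ : ℝ} (hα0 : 0 < a / k) (hα1 : a / k < 1)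
    (hc₂ : 0 < c₂) (hc₂' : c₂ ≤ 1) :
    0 ≤ c4 a k c₁ c₂ ∧ c4 a k c₁ c₂ * (1 + c4 a k c₁ c₂)
      = (c₂⁻¹ - 1) * (1 - a / k) * (a / k) / (1 - c₁) ^ 2 := by
  unfold c4
  set α := a / k
  have hp : 0 ≤ (c₂⁻¹ - 1) * (1 - α) * α / (1 - c₁) ^ 2 := by
    have h1 : 0 ≤ c₂⁻¹ - 1 := sub_nonneg.2 ((one_le_inv₀ hc₂).2 hc₂')
    have h2 : 0 ≤ 1 - α := by linarith
    positivity
  set p := (c₂⁻¹ - 1) * (1 - α) * α / (1 - c₁) ^ 2 with hpdef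
  have he : 1 + 4 * (c₂⁻¹ - 1) * (1 - α) * α / (1 - c₁) ^ 2 = 1 + 4 * p := by
    rw [hpdef]; ring
  rw [he]
  have h1 : 1 ≤ √(1 + 4 * p) := Real.one_le_sqrt.2 (by linarith)
  have h2 := Real.sq_sqrt (show 0 ≤ 1 + 4 * p by linarith)
  constructor
  · linarith
  · nlinarith

/-- The exponent is attained at an explicit value of the Laplace parameter. -/
lemma exists_laplace_parameter {a : ℝ} {k : ℕ} {c₁ c₂ : ℝ} (hα0 : 0 < a / k) (hα1 : a / k < 1)
    (hc₁ : 0 < c₁) (hc₁' : c₁ < 1) (hc₂ : 0 < c₂) (hc₂' : c₂ ≤ 1) :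
    ∃ t : ℝ,
      0 < 1 + 2 * (Real.exp t - 1) * (c₁ * c₂) + (Real.exp t - 1) ^ 2 * (c₁ ^ 2 * c₂) ∧
      binDiv (a / k) c₁ + c3 a k c₁ c₂ = t * (a / k) - 1 / 2 * Real.log
        (1 + 2 * (Real.exp t - 1) * (c₁ * c₂) + (Real.exp t - 1) ^ 2 * (c₁ ^ 2 * c₂)) ∧
      (c₁ * c₂ ≤ a / k → 0 ≤ t) ∧ (a / k ≤ c₁ * c₂ → t ≤ 0) := by
  obtain ⟨hw0, hw⟩ := c4_nonneg_and_quadratic (c₁ := c₁) hα0 hα1 hc₂ hc₂'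
  unfold c3 binDiv
  set α := a / k
  set w := c4 a k c₁ c₂
  set β := (1 - α) / (1 - c₁) with hβ
  have h1α : 0 < 1 - α := by linarith
  have h1c : 0 < 1 - c₁ := by linarith
  have hβ0 : 0 < β := by positivity
  have hwα : 0 < w + α := by linarith
  have hβc : β * (1 - c₁) = 1 - α := div_mul_cancel₀ _ h1c.ne'
  have hρ : 0 < (w + α) / (c₁ * β) := by positivity
  have hexp : Real.exp (Real.log ((w + α) / (c₁ * β))) = (w + α) / (c₁ * β) := Real.exp_log hρ
  have hL : 0 < c₂ * (1 + w) ^ 2 + (1 - c₂) * β ^ 2 := by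
    have : 0 ≤ 1 - c₂ := by linarith
    positivity
  -- Completing the square gives `g = c₂ (1 + s c₁) ^ 2 + (1 - c₂)`, and the chosen `exp t = (w + α)
  -- / (c₁ β)` makes `1 + s c₁ = (1 + w) / β`.
  have hg : 1 + 2 * ((w + α) / (c₁ * β) - 1) * (c₁ * c₂)
      + ((w + α) / (c₁ * β) - 1) ^ 2 * (c₁ ^ 2 * c₂)
      = (c₂ * (1 + w) ^ 2 + (1 - c₂) * β ^ 2) / β ^ 2 := by
    have hs : 1 + ((w + α) / (c₁ * β) - 1) * c₁ = (1 + w) / β := by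
      field_simp
      linarith
    calc _ = c₂ * (1 + ((w + α) / (c₁ * β) - 1) * c₁) ^ 2 + (1 - c₂) := by ring
      _ = _ := by rw [hs]; field_simp
  have hquad : (c₁ * β - α) * (1 + (c₁ * β - α)) = (c₁ - α) * (1 - α) / (1 - c₁) ^ 2 := by
    rw [hβ]; field_simp; ring
  have hcmp : c₂⁻¹ * (c₁ * c₂ - α) = (c₁ - α) - (c₂⁻¹ - 1) * α := by
    field_simp; ring
  have hden : 0 < (1 - α) / (1 - c₁) ^ 2 := by positivity
  -- The sign of `t` is that of `w - (c₁ β - α)`. As `x ↦ x (1 + x)` increases on `x ≥ 0`, comparing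
  -- its values at these two points reduces the question to the sign of `c₁ c₂ - α`.
  have hdiff : (c₁ * β - α) * (1 + (c₁ * β - α)) - w * (1 + w)
      = c₂⁻¹ * (c₁ * c₂ - α) * ((1 - α) / (1 - c₁) ^ 2) := by
    rw [hquad, hw, hcmp]; ring
  have hinv : 0 < c₂⁻¹ := inv_pos.2 hc₂
  refine ⟨Real.log ((w + α) / (c₁ * β)), ?_, ?_, fun h => ?_, fun h => ?_⟩
  · rw [hexp, hg]; positivity
  · rw [hexp, hg, Real.log_div hL.ne' (pow_pos hβ0 2).ne', Real.log_div hwα.ne' (mul_pos hc₁ hβ0).ne',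
      Real.log_mul hc₁.ne' hβ0.ne', Real.log_pow, Real.log_div hα0.ne' hc₁.ne',
      Real.log_div hwα.ne' hα0.ne']
    push_cast
    ring
  · refine Real.log_nonneg ((one_le_div (by positivity)).2 ?_)
    by_contra! hlt
    have h1 : c₂⁻¹ * (c₁ * c₂ - α) * ((1 - α) / (1 - c₁) ^ 2) ≤ 0 :=
      mul_nonpos_of_nonpos_of_nonneg
        (mul_nonpos_of_nonneg_of_nonpos hinv.le (by linarith)) hden.le
    nlinarith
  · refine Real.log_nonpos hρ.le ((div_le_one (by positivity)).2 ?_)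
    by_contra! hlt
    have h1 : 0 ≤ c₂⁻¹ * (c₁ * c₂ - α) * ((1 - α) / (1 - c₁) ^ 2) :=
      mul_nonneg (mul_nonneg hinv.le (by linarith)) hden.le
    -- Nonnegativity puts both points in the range where `x (1 + x)` is monotone.
    have h2 : 0 ≤ c₁ * β - α := by
      have : c₁ * c₂ ≤ c₁ := mul_le_of_le_one_right hc₁.le hc₂'
      have h3 : c₁ * β - α = (c₁ - α) / (1 - c₁) := by rw [hβ]; field_simp; ring
      rw [h3]
      exact div_nonneg (by linarith) h1c.le
    nlinarith

end Scalar

/-! ### Row outer products -/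

section RowOuter

variable {m n k : ℕ}

/-- The outer product of the row `c • (x ∘ e)` with itself. -/
def outerOn (c : ℝ) (e : Fin k → Fin n) (x : Fin n → ℝ) : Matrix (Fin k) (Fin k) ℝ :=
  Matrix.vecMulVec (fun l => c * x (e l)) (fun l => c * x (e l))

lemma measurable_outerOn_apply (c : ℝ) (e : Fin k → Fin n) (i j : Fin k) :
    Measurable fun x : Fin n → ℝ => outerOn c e x i j := by
  simp only [outerOn, vecMulVec_apply]
  fun_prop

lemma posSemidef_outerOn (c : ℝ) (e : Fin k → Fin n) (x : Fin n → ℝ) :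
    (outerOn c e x).PosSemidef := by
  have h := posSemidef_vecMulVec_self_star (fun l => c * x (e l))
  rwa [star_trivial] at h

lemma sum_outerOn (c : ℝ) (A : Matrix (Fin m) (Fin n) ℝ) (S : Finset (Fin n)) (hS : S.card = k) :
    ∑ r, outerOn c (S.orderEmbOfFin hS) (A r)
      = c ^ 2 • ((colSubmatrix A S hS)ᵀ * colSubmatrix A S hS) := by
  ext i j
  simp only [Matrix.sum_apply, outerOn, vecMulVec_apply, Matrix.smul_apply, mul_apply, transpose_apply,
    colSubmatrix, submatrix_apply, id, smul_eq_mul, Finset.mul_sum]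
  exact Finset.sum_congr rfl fun r _ => by ring

lemma sq_entry_le (hm : 0 < m) (hk : 0 < k) {x : ℝ} (hx : |x| ≤ 1 / √(m : ℝ)) :
    (√((m : ℝ) / k) * x) ^ 2 ≤ 1 / k := by
  have hm' : (0 : ℝ) < m := by exact_mod_cast hm
  have hk' : (0 : ℝ) < k := by exact_mod_cast hk
  have h1 : x ^ 2 ≤ 1 / m := by
    have h := pow_le_pow_left₀ (abs_nonneg x) hx 2
    rwa [sq_abs, div_pow, one_pow, Real.sq_sqrt hm'.le] at h
  rw [mul_pow, Real.sq_sqrt (by positivity)]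
  calc (m : ℝ) / k * x ^ 2 ≤ m / k * (1 / m) := by gcongr
    _ = 1 / k := by field_simp

lemma trace_outerOn_le (hm : 0 < m) (hk : 0 < k) (e : Fin k → Fin n) {x : Fin n → ℝ}
    (hx : ∀ j, |x j| ≤ 1 / √(m : ℝ)) : (outerOn √((m : ℝ) / k) e x).trace ≤ 1 := by
  have hk' : (0 : ℝ) < k := by exact_mod_cast hk
  calc (outerOn √((m : ℝ) / k) e x).trace = ∑ l, (√((m : ℝ) / k) * x (e l)) ^ 2 := by
        simp only [outerOn, trace_vecMulVec, dotProduct, sq]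
    _ ≤ ∑ _l : Fin k, 1 / (k : ℝ) := Finset.sum_le_sum fun l _ => sq_entry_le hm hk (hx _)
    _ = 1 := by simp [hk'.ne']

lemma norm_outerOn_apply_le (hm : 0 < m) (hk : 0 < k) (e : Fin k → Fin n) {x : Fin n → ℝ}
    (hx : ∀ j, |x j| ≤ 1 / √(m : ℝ)) (i j : Fin k) : ‖outerOn √((m : ℝ) / k) e x i j‖ ≤ 1 / k := by
  rw [outerOn, vecMulVec_apply, Real.norm_eq_abs]
  have h1 := sq_entry_le hm hk (hx (e i))
  have h2 := sq_entry_le hm hk (hx (e j))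
  set u := √((m : ℝ) / k) * x (e i)
  set v := √((m : ℝ) / k) * x (e j)
  -- From here, `2 |u v| ≤ u ^ 2 + v ^ 2`.
  rw [abs_le]
  constructor
  · nlinarith [sq_nonneg (u + v)]
  · nlinarith [sq_nonneg (u - v)]

end RowOuter

/-! ### First and mixed moments -/

section Expectation

variable {Ω : Type*} [MeasurableSpace Ω] {μ : Measure Ω} {k : ℕ}
  {X : Ω → Matrix (Fin k) (Fin k) ℝ}

lemma integral_trace_mul (hX : ∀ i j, Integrable (fun ω => X ω i j) μ)
    (C : Matrix (Fin k) (Fin k) ℝ) :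
    ∫ ω, (C * X ω).trace ∂μ = (C * expMatrix μ X).trace := by
  simp only [trace, diag_apply, mul_apply, expMatrix, of_apply]
  rw [integral_finsetSum _ fun i _ => integrable_finsetSum _ fun j _ => (hX j i).const_mul (C i j)]
  refine Finset.sum_congr rfl fun i _ => ?_
  rw [integral_finsetSum _ fun j _ => (hX j i).const_mul (C i j)]
  exact Finset.sum_congr rfl fun j _ => integral_const_mul _ _

lemma isHermitian_expMatrix (hX : ∀ ω, (X ω).IsHermitian) : (expMatrix μ X).IsHermitian := by
  ext i j
  simp only [conjTranspose_apply, expMatrix, of_apply, star_trivial]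
  exact integral_congr_ae (Eventually.of_forall fun ω => by simpa using (hX ω).apply i j)

lemma mul_integral_trace_mul_le_of_eigMax_le (hX : ∀ i j, Integrable (fun ω => X ω i j) μ)
    (hH : ∀ ω, (X ω).IsHermitian) {τ s : ℝ} (hτ : eigMax (expMatrix μ X) ≤ τ) (hs : 0 ≤ s)
    {C : Matrix (Fin k) (Fin k) ℝ} (hC : C.PosSemidef) :
    s * ∫ ω, (C * X ω).trace ∂μ ≤ s * (τ * C.trace) := by
  rw [integral_trace_mul hX]
  exact mul_le_mul_of_nonneg_left (trace_mul_le_of_spectrum_le (isHermitian_expMatrix hH) hC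
    fun l hl => (le_eigMax l hl).trans hτ) hs

lemma mul_integral_trace_mul_le_of_le_eigMin (hX : ∀ i j, Integrable (fun ω => X ω i j) μ)
    (hH : ∀ ω, (X ω).IsHermitian) {τ s : ℝ} (hτ : τ ≤ eigMin (expMatrix μ X)) (hs : s ≤ 0)
    {C : Matrix (Fin k) (Fin k) ℝ} (hC : C.PosSemidef) :
    s * ∫ ω, (C * X ω).trace ∂μ ≤ s * (τ * C.trace) := by
  rw [integral_trace_mul hX]
  exact mul_le_mul_of_nonpos_left (le_trace_mul_of_le_spectrum (isHermitian_expMatrix hH) hC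
    fun l hl => hτ.trans (eigMin_le l hl)) hs

/-- Test with `C = D = 1`: the left side is the mean of a product of nonnegative traces. -/
lemma nonneg_of_integral_trace_mul_le {Y : Ω → Matrix (Fin k) (Fin k) ℝ} {τq : ℝ} (hk : 0 < k)
    (hX : ∀ ω, (X ω).PosSemidef) (hY : ∀ ω, (Y ω).PosSemidef)
    (hτq : ∀ C D : Matrix (Fin k) (Fin k) ℝ, C.PosSemidef → D.PosSemidef →
      ∫ ω, (C * X ω).trace * (D * Y ω).trace ∂μ ≤ τq * (C.trace * D.trace)) : 0 ≤ τq := by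
  have hk' : (0 : ℝ) < k := by exact_mod_cast hk
  have h := hτq 1 1 PosSemidef.one PosSemidef.one
  simp only [Matrix.one_mul, trace_one, Fintype.card_fin] at h
  have h0 : 0 ≤ ∫ ω, (X ω).trace * (Y ω).trace ∂μ :=
    integral_nonneg fun ω => mul_nonneg (hX ω).trace_nonneg (hY ω).trace_nonneg
  exact nonneg_of_mul_nonneg_left (h0.trans h) (by positivity)

end Expectation

/-! ### Assembly of the joint tail bound -/

/-- The exponential bound in terms of the optimal exponent. -/
lemma pow_mul_exp_eq {m : ℕ} {g t α V : ℝ} (hg : 0 < g) (hV : V = t * α - 1 / 2 * Real.log g) :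
    g ^ m * Real.exp (-(2 * (t * (m * α)))) = Real.exp (-(m : ℝ) * (2 * V)) := by
  rw [hV, ← Real.exp_log (pow_pos hg m), ← Real.exp_add, Real.log_pow]
  congr 1
  ring

/-- Dictionary for `c₁ = τq / τ` and `c₂ = τ ^ 2 / τq`: `τq < τ` gives `c₁ < 1`, `τ ≤ √τq` gives `c₂
≤ 1`, and the last two identities recover the coefficients of `g`. -/
lemma parameter_bounds {τ τq : ℝ} (hq : 0 ≤ τq) (hlt : τq < τ) (hle : τ ≤ √τq) :
    0 < τq ∧ 0 < τ ∧ 0 < τq / τ ∧ τq / τ < 1 ∧ 0 < τ ^ 2 / τq ∧ τ ^ 2 / τq ≤ 1 ∧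
      τq / τ * (τ ^ 2 / τq) = τ ∧ (τq / τ) ^ 2 * (τ ^ 2 / τq) = τq := by
  have hτ : 0 < τ := hq.trans_lt hlt
  have hq' : 0 < τq := Real.sqrt_pos.1 (hτ.trans_le hle)
  have hsq : τ ^ 2 ≤ τq := (Real.le_sqrt hτ.le hq).1 hle
  refine ⟨hq', hτ, by positivity, (div_lt_one hτ).2 hlt, by positivity, (div_le_one hq').2 hsq,
    ?_, ?_⟩ <;> field_simp

/-- The joint tail bound, for an event on which both Gram matrices have an eigenvalue on the side
of `a` prescribed by the sign of the Laplace parameter. -/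
theorem measureReal_joint_tail_le {Ω : Type*} [MeasurableSpace Ω] {μ : Measure Ω}
    [IsProbabilityMeasure μ] {m n k : ℕ} (hm : 0 < m) (hk : 0 < k)
    {A : Ω → Matrix (Fin m) (Fin n) ℝ}
    (hA_meas : ∀ r j, Measurable fun ω => A ω r j)
    (hA_bdd : ∀ r j, ∀ᵐ ω ∂μ, |A ω r j| ≤ 1 / √(m : ℝ))
    (hA_indep : iIndepFun (fun (r : Fin m) (ω : Ω) => fun j : Fin n => A ω r j) μ)
    (hA_row : ∀ r r' : Fin m,
      IdentDistrib (fun ω => fun j : Fin n => A ω r j) (fun ω => fun j : Fin n => A ω r' j) μ μ)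
    {S R : Finset (Fin n)} (hS : S.card = k) (hR : R.card = k)
    {X Y : Ω → Matrix (Fin k) (Fin k) ℝ}
    (hX : ∀ ω, X ω = rowOuter (√((m : ℝ) / k) • colSubmatrix (A ω) S hS) ⟨0, hm⟩)
    (hY : ∀ ω, Y ω = rowOuter (√((m : ℝ) / k) • colSubmatrix (A ω) R hR) ⟨0, hm⟩)
    {τ τq : ℝ}
    (hτq : ∀ C D : Matrix (Fin k) (Fin k) ℝ, C.PosSemidef → D.PosSemidef →
      ∫ ω, (C * X ω).trace * (D * Y ω).trace ∂μ ≤ τq * (C.trace * D.trace))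
    (hlt : τq < τ) (hle : τ ≤ √τq) {a : ℝ} (ha0 : 0 < a) (hak : a < k)
    (hside : ∀ t : ℝ, (τ ≤ a / k → 0 ≤ t) → (a / k ≤ τ → t ≤ 0) →
      ∀ Z : Ω → Matrix (Fin k) (Fin k) ℝ, Z = X ∨ Z = Y →
      (∀ i j, Integrable (fun ω => Z ω i j) μ) → (∀ ω, (Z ω).IsHermitian) →
      ∀ C : Matrix (Fin k) (Fin k) ℝ, C.PosSemidef →
        (Real.exp t - 1) * ∫ ω, (C * Z ω).trace ∂μ ≤ (Real.exp t - 1) * (τ * C.trace))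
    {E : Set Ω}
    (hE : ∀ t : ℝ, (τ ≤ a / k → 0 ≤ t) → (a / k ≤ τ → t ≤ 0) → ∀ ω ∈ E,
      (∃ l ∈ spectrum ℝ ((colSubmatrix (A ω) S hS)ᵀ * colSubmatrix (A ω) S hS), t * a ≤ t * l) ∧
      ∃ l ∈ spectrum ℝ ((colSubmatrix (A ω) R hR)ᵀ * colSubmatrix (A ω) R hR), t * a ≤ t * l) :
    μ.real E ≤ (k : ℝ) ^ 2 * Real.exp (-(m : ℝ) * (2 *
      (binDiv (a / k) (τq / τ) + c3 a k (τq / τ) (τ ^ 2 / τq)))) := by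
  have hm' : (0 : ℝ) < m := by exact_mod_cast hm
  have hk' : (0 : ℝ) < k := by exact_mod_cast hk
  have : Nonempty (Fin k) := ⟨⟨0, hk⟩⟩
  set c := √((m : ℝ) / k)
  have hX' (ω : Ω) : X ω = outerOn c (S.orderEmbOfFin hS) (A ω ⟨0, hm⟩) := hX ω
  have hY' (ω : Ω) : Y ω = outerOn c (R.orderEmbOfFin hR) (A ω ⟨0, hm⟩) := hY ω
  have hrow (r : Fin m) : ∀ᵐ ω ∂μ, ∀ j, |A ω r j| ≤ 1 / √(m : ℝ) := ae_all_iff.2 (hA_bdd r)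
  have hrm (r : Fin m) : Measurable fun ω => A ω r := measurable_pi_lambda _ (hA_meas r)
  have hmeas (e : Fin k → Fin n) (r : Fin m) (i j : Fin k) :
      Measurable fun ω => outerOn c e (A ω r) i j :=
    (measurable_outerOn_apply c e i j).comp (hrm r)
  have hint (e : Fin k → Fin n) (i j : Fin k) :
      Integrable (fun ω => outerOn c e (A ω ⟨0, hm⟩) i j) μ :=
    Integrable.of_bound (hmeas e _ i j).aestronglyMeasurable (1 / k)
      ((hrow _).mono fun ω h => norm_outerOn_apply_le hm hk e h i j)
  have hq0 : 0 ≤ τq := nonneg_of_integral_trace_mul_le hk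
    (fun ω => by rw [hX']; exact posSemidef_outerOn _ _ _)
    (fun ω => by rw [hY']; exact posSemidef_outerOn _ _ _) hτq
  obtain ⟨hq, hτ, hc1, hc1', hc2, hc2', h12, h112⟩ := parameter_bounds hq0 hlt hle
  obtain ⟨t, hg, hV, ht1, ht2⟩ := exists_laplace_parameter (div_pos ha0 hk')
    ((div_lt_one hk').2 hak) hc1 hc1' hc2 hc2'
  rw [h12] at hg hV ht1 ht2
  rw [h112] at hg hV
  have hpair (r : Fin m) : Measurable fun x : Fin n → ℝ =>
      entryPair (outerOn c (S.orderEmbOfFin hS) x) (outerOn c (R.orderEmbOfFin hR) x) :=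
    Measurable.prodMk
      (measurable_pi_lambda _ fun i => measurable_pi_lambda _ fun j => measurable_outerOn_apply ..)
      (measurable_pi_lambda _ fun i => measurable_pi_lambda _ fun j => measurable_outerOn_apply ..)
  have hXe : X = fun ω => outerOn c (S.orderEmbOfFin hS) (A ω ⟨0, hm⟩) := funext hX'
  have hYe : Y = fun ω => outerOn c (R.orderEmbOfFin hR) (A ω ⟨0, hm⟩) := funext hY'
  have hside' := hside t ht1 ht2
  subst hXe hYe
  have hlap := lintegral_trace_exp_sum_le (μ := μ) (t := t) (τ := τ) (τq := τq)
    (X := fun r ω => outerOn c (S.orderEmbOfFin hS) (A ω r))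
    (Y := fun r ω => outerOn c (R.orderEmbOfFin hR) (A ω r)) ⟨0, hm⟩
    (fun r => hmeas _ r) (fun r => hmeas _ r)
    (fun r ω => posSemidef_outerOn _ _ _) (fun r ω => posSemidef_outerOn _ _ _)
    (hA_indep.comp _ hpair) (fun r => (hA_row r _).comp (hpair r))
    ((hrow _).mono fun ω h => trace_outerOn_le hm hk _ h)
    ((hrow _).mono fun ω h => trace_outerOn_le hm hk _ h)
    (hside' _ (Or.inl rfl) (hint _) fun ω => (posSemidef_outerOn _ _ _).1)
    (hside' _ (Or.inr rfl) (hint _) fun ω => (posSemidef_outerOn _ _ _).1)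
    hτq hg.le Finset.univ
  simp_rw [sum_outerOn, Fintype.card_fin] at hlap
  rw [Finset.card_univ, Fintype.card_fin] at hlap
  have hc2sq : c ^ 2 = (m : ℝ) / k := Real.sq_sqrt (by positivity)
  have hgram (T : Finset (Fin n)) (hT : T.card = k) (i j : Fin k) : Measurable fun ω =>
      (c ^ 2 • ((colSubmatrix (A ω) T hT)ᵀ * colSubmatrix (A ω) T hT)) i j := by
    simp_rw [← sum_outerOn, Matrix.sum_apply]
    exact Finset.measurable_sum _ fun r _ => hmeas _ r i j
  have hherm (B : Matrix (Fin m) (Fin k) ℝ) : (Bᵀ * B).IsHermitian := by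
    simpa using isHermitian_conjTranspose_mul_self B
  -- The row sum is `m / k` times the Gram matrix, so the threshold `a` becomes `m * (a / k)`. Any
  -- eigenvalue past it suffices, as the trace of the exponential dominates each of its terms.
  have hexp (B : Matrix (Fin m) (Fin k) ℝ) (h : ∃ l ∈ spectrum ℝ (Bᵀ * B), t * a ≤ t * l) :
      Real.exp (t * (m * (a / k))) ≤ (NormedSpace.exp (t • c ^ 2 • (Bᵀ * B))).trace := by
    obtain ⟨l, hl, hal⟩ := h
    rw [smul_smul]
    refine le_trans (Real.exp_le_exp.2 ?_) (exp_le_trace_exp (hherm B) hl _)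
    rw [hc2sq]
    calc t * (m * (a / k)) = (m / k) * (t * a) := by ring
      _ ≤ (m / k) * (t * l) := by gcongr
      _ = t * (m / k) * l := by ring
  refine (measureReal_le_of_lintegral_trace_exp_le (hgram S hS) (hgram R hR) (by positivity) hlap
    (b := m * (a / k)) (E := E) fun ω hω => ?_).trans_eq ?_
  · obtain ⟨h1, h2⟩ := hE t ht1 ht2 ω hω
    exact ⟨hexp _ h1, hexp _ h2⟩
  · rw [← pow_mul_exp_eq hg hV]
    ring

end JointTail

end

/-! ### The two tails -/

theorem proposition1 {Ω : Type*} [MeasurableSpace Ω] (μ : Measure Ω) [IsProbabilityMeasure μ]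
    {m n k i : ℕ} (hm : 0 < m)
    -- the random matrix, with entries bounded by `1 / √m`
    (A : Ω → Matrix (Fin m) (Fin n) ℝ)
    (hA_meas : ∀ r j, Measurable fun ω => A ω r j)
    (hA_bdd : ∀ r j, ∀ᵐ ω ∂μ, |A ω r j| ≤ 1 / √(m : ℝ))
    -- the columns are identically distributed
    (hA_col : ∀ j j' : Fin n,
      IdentDistrib (fun ω => fun r : Fin m => A ω r j) (fun ω => fun r : Fin m => A ω r j') μ μ)
    -- the rows are independent and identically distributed
    (hA_indep : iIndepFun (fun (r : Fin m) (ω : Ω) => fun j : Fin n => A ω r j) μ)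
    (hA_row : ∀ r r' : Fin m,
      IdentDistrib (fun ω => fun j : Fin n => A ω r j) (fun ω => fun j : Fin n => A ω r' j) μ μ)
    -- two size-`k` index sets that share exactly `i` elements
    (S R : Finset (Fin n)) (hS : S.card = k) (hR : R.card = k)
    (hi : 1 ≤ i) (hik : i < k) (hSR : (S ∩ R).card = i)
    -- the first row outer products of `√(m/k) A_S` and `√(m/k) A_R`
    (X Y : Ω → Matrix (Fin k) (Fin k) ℝ)
    (hX : ∀ ω, X ω =
      JointTail.rowOuter (√((m : ℝ) / k) • JointTail.colSubmatrix (A ω) S hS) ⟨0, hm⟩)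
    (hY : ∀ ω, Y ω =
      JointTail.rowOuter (√((m : ℝ) / k) • JointTail.colSubmatrix (A ω) R hR) ⟨0, hm⟩)
    (τq τpmax τpmin : ℝ)
    (hτq : ∀ C D : Matrix (Fin k) (Fin k) ℝ, C.PosSemidef → D.PosSemidef →
      ∫ ω, (C * X ω).trace * (D * Y ω).trace ∂μ ≤ τq * (C.trace * D.trace))
    (hτpmax : τpmax = JointTail.eigMax (JointTail.expMatrix μ X))
    (hτpmin : τpmin = JointTail.eigMin (JointTail.expMatrix μ X))
    (hτ : max τpmax τpmin ≤ √τq) :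
    -- upper tails; `τq < τpmax` says that `τq / τpmax` is a Bernoulli parameter below `1`
    (JointTail.eigMax (JointTail.expMatrix μ Y) ≤ τpmax → τq < τpmax →
      ∀ a : ℝ, k * τpmax < a → a < k →
        μ.real {ω | a < JointTail.sqSingMax (JointTail.colSubmatrix (A ω) S hS) ∧
            a < JointTail.sqSingMax (JointTail.colSubmatrix (A ω) R hR)} ≤
          (k : ℝ) ^ 2 * Real.exp (-(m : ℝ) * (2 *
            (JointTail.binDiv (a / k) (τq / τpmax)
              + JointTail.c3 a k (τq / τpmax) (τpmax ^ 2 / τq))))) ∧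
    -- lower tails
    (τpmin ≤ JointTail.eigMin (JointTail.expMatrix μ Y) → τq < τpmin →
      ∀ a : ℝ, 0 < a → a < k * τpmin →
        μ.real {ω | JointTail.sqSingMin (JointTail.colSubmatrix (A ω) S hS) < a ∧
            JointTail.sqSingMin (JointTail.colSubmatrix (A ω) R hR) < a} ≤
          (k : ℝ) ^ 2 * Real.exp (-(m : ℝ) * (2 *
            (JointTail.binDiv (a / k) (τq / τpmin)
              + JointTail.c3 a k (τq / τpmin) (τpmin ^ 2 / τq))))) := by
  have hk : 0 < k := by omega
  have hk' : (0 : ℝ) < k := by exact_mod_cast hk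
  have hq0 : 0 ≤ τq := JointTail.nonneg_of_integral_trace_mul_le hk
    (fun ω => by rw [hX]; exact JointTail.posSemidef_outerOn _ _ _)
    (fun ω => by rw [hY]; exact JointTail.posSemidef_outerOn _ _ _) hτq
  refine ⟨fun hYmax hlt a ha hak => ?_, fun hYmin hlt a ha hak => ?_⟩
  · have ha0 : 0 < a := (mul_pos hk' (hq0.trans_lt hlt)).trans ha
    have hα : τpmax ≤ a / k := by rw [le_div_iff₀ hk', mul_comm]; exact ha.le
    refine JointTail.measureReal_joint_tail_le hm hk hA_meas hA_bdd hA_indep hA_row hS hR hX hY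
      hτq hlt ((le_max_left _ _).trans hτ) ha0 hak ?_ ?_
    · intro t ht _ Z hZ hZi hZh C hC
      refine JointTail.mul_integral_trace_mul_le_of_eigMax_le hZi hZh ?_
        (sub_nonneg.2 (Real.one_le_exp (ht hα))) hC
      rcases hZ with rfl | rfl
      · exact hτpmax.ge
      · exact hYmax
    · rintro t ht - ω ⟨h1, h2⟩
      exact ⟨⟨_, JointTail.sq_singularValues_mem_spectrum _ hk,
        mul_le_mul_of_nonneg_left h1.le (ht hα)⟩, ⟨_, JointTail.sq_singularValues_mem_spectrum _ hk,
        mul_le_mul_of_nonneg_left h2.le (ht hα)⟩⟩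
  · have hα : a / k ≤ τpmin := by rw [div_le_iff₀ hk', mul_comm]; exact hak.le
    have hle : τpmin ≤ √τq := (le_max_right _ _).trans hτ
    have hτ0 : 0 < τpmin := hq0.trans_lt hlt
    -- From `τpmin ^ 2 ≤ τq < τpmin`; this supplies `a < k`, which is not assumed for the lower
    -- tail.
    have hτ1 : τpmin < 1 := by
      have hsq : τpmin ^ 2 ≤ τq := (Real.le_sqrt hτ0.le hq0).1 hle
      nlinarith
    -- Singular values are indexed from zero, so the smallest of the `k` has index `k - 1`.
    have hk1 : k - 1 < k := by omega
    refine JointTail.measureReal_joint_tail_le hm hk hA_meas hA_bdd hA_indep hA_row hS hR hX hY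
      hτq hlt hle ha (hak.trans (mul_lt_of_lt_one_right hk' hτ1)) ?_ ?_
    · intro t _ ht Z hZ hZi hZh C hC
      refine JointTail.mul_integral_trace_mul_le_of_le_eigMin hZi hZh ?_
        (sub_nonpos.2 (Real.exp_le_one_iff.2 (ht hα))) hC
      rcases hZ with rfl | rfl
      · exact hτpmin.le
      · exact hYmin
    · rintro t - ht ω ⟨h1, h2⟩
      exact ⟨⟨_, JointTail.sq_singularValues_mem_spectrum _ hk1,
        mul_le_mul_of_nonpos_left h1.le (ht hα)⟩, ⟨_, JointTail.sq_singularValues_mem_spectrum _ hk1,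
        mul_le_mul_of_nonpos_left h2.le (ht hα)⟩⟩
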